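/- Let $X$ be a real Banach space, $A\subset X$, $B\subset X^*$ and $\epsilon>0$. Put $P_0(\epsilon,A,B)=B$; given $P_\alpha(\epsilon,A,B)$, let $P_{\alpha+1}(\epsilon,A,B)$ be the set of all $b\in B$ for which there are sequences $(a_n)\subset A$ and $(b_n)\subset P_\alpha(\epsilon,A,B)$ such that $b_n\to b$ in the weak* topology, $a_n\to 0$ weakly, and $\lim_n b_n(a_n)$ exists and is at least $\epsilon$; for a limit ordinal $\alpha$ let $P_\alpha(\epsilon,A,B)=\bigcap_{\beta<\alpha}P_\beta(\epsilon,A,B)$. The $\epsilon$-Szlenk index $\eta(\epsilon,A,B)$ is the smallest ordinal $\alpha$ with $P_\alpha(\epsilon,A,B)=\emptyset$, with the convention $\eta(\epsilon,A,B)=\omega_1$ if there is no countable such $\alpha$. If $A$ is not mentioned, it is the closed unit ball of $X$. For an ordinal $\alpha\ge 1$ let $C(\alpha)$ be the Banach space of continuous real-valued functions on the ordinal interval $[1,\alpha]$ (order topology) with the supremum norm. **Corollary.** Let $\gamma$ be a countable ordinal, let $k\ge 0$ be an integer, and let $\epsilon>0$ be a real number such that $\epsilon\le 1$ or $\epsilon>k$.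 Then the $\epsilon$-Szlenk index of the closed unit ball of $C(\omega^{\omega^\gamma\cdot k})^*$ is $$\omega^\gamma\cdot\lfloor k/\epsilon\rfloor+1 ,$$ where powers, products and sums of ordinals are the ordinal operations and $\lfloor\cdot\rfloor$ is the greatest integer function. -/

import Mathlib

open Filter Topology
open scoped Ordinal

namespace SzlenkIndex

section General

variable {X : Type*} [NormedAddCommGroup X] [NormedSpace ℝ X]

/-- One step of the Szlenk derivation: given `P ⊆ B ⊆ X*`, the set of all `b ∈ B` for which there
are sequences `(a n)` in `A` and `(b n)` in `P` such that `b n → b` in the weak* topology,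
`lim (b n) (a n)` exists and is at least `ε`, and `a n → 0` weakly. -/
def szlenkStep (ε : ℝ) (A : Set X) (B P : Set (StrongDual ℝ X)) : Set (StrongDual ℝ X) :=
  {b | b ∈ B ∧ ∃ (a : ℕ → X) (f : ℕ → StrongDual ℝ X),
    (∀ n, a n ∈ A) ∧ (∀ n, f n ∈ P) ∧
    Tendsto (fun n => StrongDual.toWeakDual (f n)) atTop (𝓝 (StrongDual.toWeakDual b)) ∧
    (∃ L : ℝ, ε ≤ L ∧ Tendsto (fun n => f n (a n)) atTop (𝓝 L)) ∧
    Tendsto (fun n => toWeakSpace ℝ X (a n)) atTop (𝓝 (toWeakSpace ℝ X 0))}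

/-- The transfinite family of Szlenk sets `P_α(ε, A, B)`: `P_0 = B`, successor stages are obtained
by `szlenkStep`, and limit stages are the intersections of all earlier stages. -/
noncomputable def szlenkSet (ε : ℝ) (A : Set X) (B : Set (StrongDual ℝ X)) (α : Ordinal.{0}) :
    Set (StrongDual ℝ X) :=
  Ordinal.limitRecOn α B (fun _ P => szlenkStep ε A B P)
    (fun α _ P => ⋂ (β : Ordinal.{0}) (h : β < α), P β h)

theorem szlenkSet_zero (ε : ℝ) (A : Set X) (B : Set (StrongDual ℝ X)) :
    szlenkSet ε A B 0 = B := by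
  simp [szlenkSet]

theorem szlenkSet_add_one (ε : ℝ) (A : Set X) (B : Set (StrongDual ℝ X)) (α : Ordinal.{0}) :
    szlenkSet ε A B (α + 1) = szlenkStep ε A B (szlenkSet ε A B α) := by
  simp [szlenkSet]

theorem szlenkSet_limit (ε : ℝ) (A : Set X) (B : Set (StrongDual ℝ X)) {α : Ordinal.{0}}
    (hα : Order.IsSuccLimit α) :
    szlenkSet ε A B α = ⋂ (β : Ordinal.{0}) (_ : β < α), szlenkSet ε A B β := by
  simp [szlenkSet, Ordinal.limitRecOn_limit _ _ _ _ hα]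

/-- The `ε`-Szlenk index `η(ε, A, B)`: the smallest ordinal `α` with `P_α(ε, A, B) = ∅`, with the
convention that it is `ω₁` if there is no countable such `α`. -/
noncomputable def szlenkIndex (ε : ℝ) (A : Set X) (B : Set (StrongDual ℝ X)) : Ordinal.{0} :=
  sInf (insert (ω_ 1) {α : Ordinal.{0} | szlenkSet ε A B α = ∅})

end General

/-- The Banach space `C(α)` of continuous real functions on the compact ordinal interval `[1, α]`
(with its order topology), under the supremum norm. -/
abbrev COrd (α : Ordinal.{0}) : Type 1 := C(Set.Icc (1 : Ordinal.{0}) α, ℝ)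

end SzlenkIndex

/-! Put `N = ⌊k/ε⌋`. It must be shown that stage `ω ^ γ * N` is nonempty and the next one is empty
(`szlenkIndex_eq_add_one`).

Upper bound. Rank each point of the interval by the last exponent of its Cantor normal form; only
the right endpoint reaches rank `ω ^ γ * k`. Let `W i` consist of the points of rank below `ω ^ γ *
(i + 1)`, `i < k`. The sum of the variations of a ball functional on the `W i` is at most `k`, and
`ω ^ γ` derivations lower the bound by `ε` (`sum_mass_le_sub`). After `ω ^ γ * N` steps less than
`ε` is left off the endpoint. Weakly null functions are eventually small at the endpoint, so no
further derivation is possible (`ballSzlenk_eq_empty`).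

Lower bound. If `N ≠ 0` then `ε ≤ 1`, so `k ≤ N`. Take `N` atoms of mass `1/N`, all at the right
endpoint. Moving `k` of them at once costs mass `k/N ≥ ε`, and each atom can be moved through `k`
rounds of `ω ^ γ` steps. Cyclic windows of length `k` use each atom at most `k` times in `N` rounds
(`diracSum_mem_mul`, `ballSzlenk_nonempty`). -/

namespace SzlenkIndex

/-! ### Monotonicity of the derivation, and weak convergence tested pointwise. -/

section Derivation

variable {X : Type*} [NormedAddCommGroup X] [NormedSpace ℝ X]

theorem szlenkStep_mono (ε : ℝ) (A : Set X) (B : Set (StrongDual ℝ X))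
    {P Q : Set (StrongDual ℝ X)} (h : P ⊆ Q) : szlenkStep ε A B P ⊆ szlenkStep ε A B Q := by
  rintro b ⟨hb, a, f, ha, hf, h1, h2, h3⟩
  exact ⟨hb, a, f, ha, fun n => h (hf n), h1, h2, h3⟩

theorem szlenkSet_succ_subset (ε : ℝ) (A : Set X) (B : Set (StrongDual ℝ X)) (α : Ordinal.{0}) :
    szlenkSet ε A B (α + 1) ⊆ szlenkSet ε A B α := by
  induction α using Ordinal.limitRecOn with
  | zero =>
    rw [szlenkSet_add_one, szlenkSet_zero]
    exact fun b hb => hb.1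
  | add_one α ih =>
    rw [szlenkSet_add_one, szlenkSet_add_one ε A B α]
    rw [szlenkSet_add_one] at ih
    exact szlenkStep_mono ε A B ih
  | limit α hα ih =>
    intro b hb
    rw [szlenkSet_limit ε A B hα]
    simp only [Set.mem_iInter]
    intro β hβ
    apply ih β hβ
    rw [szlenkSet_add_one] at hb ⊢
    refine szlenkStep_mono ε A B ?_ hb
    rw [szlenkSet_limit ε A B hα]
    exact Set.biInter_subset_of_mem (t := fun β => szlenkSet ε A B β) hβ

theorem szlenkSet_antitone (ε : ℝ) (A : Set X) (B : Set (StrongDual ℝ X)) :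
    Antitone (szlenkSet ε A B) := by
  intro α β h
  induction β using Ordinal.limitRecOn with
  | zero => rw [nonpos_iff_eq_zero.mp h]
  | add_one β ih =>
    rcases h.lt_or_eq with h | rfl
    · exact (szlenkSet_succ_subset ε A B β).trans (ih (Order.lt_add_one_iff.mp h))
    · exact subset_rfl
  | limit β hβ ih =>
    rcases h.lt_or_eq with h | rfl
    · rw [szlenkSet_limit ε A B hβ]
      exact Set.biInter_subset_of_mem (t := fun β => szlenkSet ε A B β) h
    · exact subset_rfl

theorem szlenkIndex_eq_add_one {ε : ℝ} {A : Set X} {B : Set (StrongDual ℝ X)} {α : Ordinal.{0}}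
    (hα : α < ω_ 1) (hne : (szlenkSet ε A B α).Nonempty) (he : szlenkSet ε A B (α + 1) = ∅) :
    szlenkIndex ε A B = α + 1 := by
  apply le_antisymm
  · exact csInf_le' (Set.mem_insert_of_mem _ he)
  · refine le_csInf ⟨_, Set.mem_insert _ _⟩ ?_
    rintro β (rfl | hβ)
    · exact Order.add_one_le_of_lt hα
    · refine Order.add_one_le_of_lt (lt_of_not_ge fun h => ?_)
      obtain ⟨b, hb⟩ := hne
      have := szlenkSet_antitone ε A B h hb
      rw [Set.mem_ofPred_eq.mp hβ] at this
      exact this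

theorem tendsto_toWeakDual_iff {f : ℕ → StrongDual ℝ X} {b : StrongDual ℝ X} :
    Tendsto (fun n => StrongDual.toWeakDual (f n)) atTop (𝓝 (StrongDual.toWeakDual b)) ↔
      ∀ x, Tendsto (fun n => f n x) atTop (𝓝 (b x)) :=
  tendsto_iff_forall_eval_tendsto_topDualPairing

theorem tendsto_toWeakSpace_iff {a : ℕ → X} {x : X} :
    Tendsto (fun n => toWeakSpace ℝ X (a n)) atTop (𝓝 (toWeakSpace ℝ X x)) ↔
      ∀ f : StrongDual ℝ X, Tendsto (fun n => f (a n)) atTop (𝓝 (f x)) := by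
  refine WeakBilin.tendsto_iff_forall_eval_tendsto (topDualPairing ℝ X).flip ?_
  intro x y hxy
  by_contra hne
  obtain ⟨f, hf⟩ := SeparatingDual.exists_separating_of_ne (R := ℝ) hne
  exact hf (by simpa using LinearMap.congr_fun hxy f)

end Derivation

/-! ### Variation of a functional on open sets, without representing measures. -/

section Mass

variable {X : Type*} [TopologicalSpace X]

/-- The restriction of a continuous function to a clopen set, extended by zero. -/
noncomputable def restrictClopen (g : C(X, ℝ)) {K : Set X} (hK : IsClopen K) : C(X, ℝ) where
  toFun := K.indicator g
  continuous_toFun := by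
    refine continuous_indicator (fun a ha => ?_) g.continuous.continuousOn
    simp [hK.frontier_eq] at ha

theorem restrictClopen_apply_of_mem (g : C(X, ℝ)) {K : Set X} (hK : IsClopen K) {x : X}
    (hx : x ∈ K) : restrictClopen g hK x = g x :=
  Set.indicator_of_mem hx g

theorem restrictClopen_apply_of_notMem (g : C(X, ℝ)) {K : Set X} (hK : IsClopen K) {x : X}
    (hx : x ∉ K) : restrictClopen g hK x = 0 :=
  Set.indicator_of_notMem hx g

variable [CompactSpace X]

theorem norm_restrictClopen_le (g : C(X, ℝ)) {K : Set X} (hK : IsClopen K) {c : ℝ} (hc : 0 ≤ c)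
    (h : ∀ x ∈ K, |g x| ≤ c) : ‖restrictClopen g hK‖ ≤ c := by
  refine (ContinuousMap.norm_le _ hc).mpr fun x => ?_
  by_cases hx : x ∈ K
  · rw [restrictClopen_apply_of_mem g hK hx]; exact h x hx
  · rw [restrictClopen_apply_of_notMem g hK hx]; simpa using hc

/-- The total variation of the functional `f` on the set `W`, for open `W`. -/
noncomputable def mass (f : StrongDual ℝ C(X, ℝ)) (W : Set X) : ℝ :=
  sSup {t | ∃ g : C(X, ℝ), ‖g‖ ≤ 1 ∧ (∀ x ∉ W, g x = 0) ∧ f g = t}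

theorem apply_le_norm (f : StrongDual ℝ C(X, ℝ)) {g : C(X, ℝ)} (hg : ‖g‖ ≤ 1) : f g ≤ ‖f‖ :=
  (le_abs_self _).trans (f.le_of_opNorm_le_of_le le_rfl hg |>.trans (by simp))

theorem apply_le_mass (f : StrongDual ℝ C(X, ℝ)) {W : Set X} {g : C(X, ℝ)} (hg : ‖g‖ ≤ 1)
    (h : ∀ x ∉ W, g x = 0) : f g ≤ mass f W := by
  refine le_csSup ⟨‖f‖, ?_⟩ ⟨g, hg, h, rfl⟩
  rintro _ ⟨g, hg, _, rfl⟩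
  exact apply_le_norm f hg

theorem mass_le (f : StrongDual ℝ C(X, ℝ)) {W : Set X} {c : ℝ}
    (h : ∀ g : C(X, ℝ), ‖g‖ ≤ 1 → (∀ x ∉ W, g x = 0) → f g ≤ c) : mass f W ≤ c := by
  refine csSup_le ⟨0, 0, by simp⟩ ?_
  rintro _ ⟨g, hg, hW, rfl⟩
  exact h g hg hW

theorem exists_lt_of_lt_mass (f : StrongDual ℝ C(X, ℝ)) {W : Set X} {t : ℝ} (h : t < mass f W) :
    ∃ g : C(X, ℝ), ‖g‖ ≤ 1 ∧ (∀ x ∉ W, g x = 0) ∧ t < f g := by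
  by_contra! hc
  exact (mass_le f hc).not_gt h

theorem mass_nonneg (f : StrongDual ℝ C(X, ℝ)) (W : Set X) : 0 ≤ mass f W := by
  simpa using apply_le_mass f (W := W) (g := 0) (by simp) (by simp)

theorem mass_le_norm (f : StrongDual ℝ C(X, ℝ)) (W : Set X) : mass f W ≤ ‖f‖ :=
  mass_le f fun _ hg _ => apply_le_norm f hg

theorem mass_mono (f : StrongDual ℝ C(X, ℝ)) {V W : Set X} (h : V ⊆ W) : mass f V ≤ mass f W :=
  mass_le f fun _ hg hV => apply_le_mass f hg fun x hx => hV x fun hx' => hx (h hx')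

theorem mass_empty (f : StrongDual ℝ C(X, ℝ)) : mass f ∅ = 0 := by
  refine le_antisymm (mass_le f fun g _ h => ?_) (mass_nonneg f _)
  rw [show g = 0 from ContinuousMap.ext fun x => h x (Set.notMem_empty x), map_zero]

theorem abs_apply_le_mass (f : StrongDual ℝ C(X, ℝ)) {W : Set X} {g : C(X, ℝ)} (hg : ‖g‖ ≤ 1)
    (h : ∀ x ∉ W, g x = 0) : |f g| ≤ mass f W := by
  refine abs_le'.mpr ⟨apply_le_mass f hg h, ?_⟩
  rw [← map_neg]
  exact apply_le_mass f (by simpa using hg) fun x hx => by simp [h x hx]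

theorem mass_add_le (f : StrongDual ℝ C(X, ℝ)) {V W : Set X} (hd : Disjoint V W) :
    mass f V + mass f W ≤ mass f (V ∪ W) := by
  rw [← le_sub_iff_add_le]
  refine mass_le f fun g hg hV => ?_
  rw [le_sub_comm]
  refine mass_le f fun h hh hW => ?_
  rw [le_sub_iff_add_le, ← map_add]
  refine apply_le_mass f ((ContinuousMap.norm_le _ zero_le_one).mpr fun x => ?_) fun x hx => ?_
  · by_cases hx : x ∈ V
    · rw [ContinuousMap.add_apply, hW x (Set.disjoint_left.mp hd hx), zero_add]
      exact (g.norm_coe_le_norm x).trans hg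
    · rw [ContinuousMap.add_apply, hV x hx, add_zero]
      exact (h.norm_coe_le_norm x).trans hh
  · rw [Set.mem_union, not_or] at hx
    simp [hV x hx.1, hW x hx.2]

theorem mass_sdiff_add_le (f : StrongDual ℝ C(X, ℝ)) {K W : Set X} (h : K ⊆ W) :
    mass f K + mass f (W \ K) ≤ mass f W := by
  simpa [Set.union_sdiff_cancel h] using mass_add_le f (Set.disjoint_sdiff_right (s := K) (t := W))

theorem sum_mass_le (f : StrongDual ℝ C(X, ℝ)) {A : ℕ → Set X}
    (hA : Pairwise (Function.onFun Disjoint A)) (n : ℕ) :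
    ∑ i ∈ Finset.range n, mass f (A i) ≤ mass f (⋃ i ∈ Finset.range n, A i) := by
  induction n with
  | zero => simp [mass_empty]
  | succ n ih =>
    rw [Finset.sum_range_succ]
    refine (add_le_add_left ih _).trans ((mass_add_le f ?_).trans (mass_mono f ?_))
    · simp only [Set.disjoint_iUnion_left]
      exact fun i hi => hA (Finset.mem_range.mp hi).ne
    · intro x
      simp only [Set.mem_union, Set.mem_iUnion, Finset.mem_range]
      rintro (⟨i, hi, hx⟩ | hx)
      · exact ⟨i, by omega, hx⟩
      · exact ⟨n, by omega, hx⟩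

/-- The masses are summable, with sum at most `‖f‖`. This makes indicators of disjoint clopen sets
weakly null in the lower bound. -/
theorem tendsto_mass_of_disjoint (f : StrongDual ℝ C(X, ℝ)) {A : ℕ → Set X}
    (hA : Pairwise (Function.onFun Disjoint A)) :
    Tendsto (fun n => mass f (A n)) atTop (𝓝 0) := by
  refine Summable.tendsto_atTop_zero (summable_of_sum_range_le (c := ‖f‖)
    (fun n => mass_nonneg f _) fun n => ?_)
  exact (sum_mass_le f hA n).trans (mass_le_norm f _)

theorem apply_sub_le_of_norm_sub_le (f : StrongDual ℝ C(X, ℝ)) {g h : C(X, ℝ)} {η : ℝ} (hη : 0 ≤ η)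
    (H : ∀ x, |g x - h x| ≤ η) : f g - f h ≤ ‖f‖ * η := by
  rw [← map_sub]
  refine (le_abs_self _).trans (f.le_of_opNorm_le_of_le le_rfl ?_)
  exact (ContinuousMap.norm_le _ hη).mpr H

variable [T2Space X] [TotallyDisconnectedSpace X]

theorem exists_isClopen_approx {W : Set X} (hW : IsOpen W) {g : C(X, ℝ)}
    (hg : ∀ x ∉ W, g x = 0) {η : ℝ} (hη : 0 < η) :
    ∃ K, IsClopen K ∧ K ⊆ W ∧ ∀ x ∉ K, |g x| ≤ η := by
  obtain ⟨K, hK, h1, h2⟩ := exists_clopen_of_closed_subset_open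
    (isClosed_le continuous_const g.continuous.abs : IsClosed {x | η ≤ |g x|}) hW fun x hx => by
    by_contra h
    rw [Set.mem_ofPred_eq, hg x h, abs_zero] at hx
    exact hη.not_ge hx
  refine ⟨K, hK, h2, fun x hx => ?_⟩
  by_contra! h
  exact hx (h1 h.le)

theorem exists_isClopen_lt_apply (f : StrongDual ℝ C(X, ℝ)) {W : Set X} (hW : IsOpen W) {t : ℝ}
    (ht : t < mass f W) :
    ∃ K, IsClopen K ∧ K ⊆ W ∧ ∃ g : C(X, ℝ), ‖g‖ ≤ 1 ∧ (∀ x ∉ K, g x = 0) ∧ t < f g := by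
  obtain ⟨g, hg, h0, htg⟩ := exists_lt_of_lt_mass f ht
  obtain ⟨η, hη, hlt⟩ := exists_pos_mul_lt (sub_pos.mpr htg) ‖f‖
  obtain ⟨K, hK, hKW, hKη⟩ := exists_isClopen_approx hW h0 hη
  refine ⟨K, hK, hKW, restrictClopen g hK, norm_restrictClopen_le g hK zero_le_one fun x _ =>
    (g.norm_coe_le_norm x).trans hg, fun x => restrictClopen_apply_of_notMem g hK, ?_⟩
  have := apply_sub_le_of_norm_sub_le f (g := g) (h := restrictClopen g hK) hη.le fun x => by
    by_cases hx : x ∈ K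
    · simpa [restrictClopen_apply_of_mem g hK hx] using hη.le
    · simpa [restrictClopen_apply_of_notMem g hK hx] using hKη x hx
  linarith

theorem mass_union_le (f : StrongDual ℝ C(X, ℝ)) {V W : Set X} (hV : IsOpen V) (hW : IsOpen W) :
    mass f (V ∪ W) ≤ mass f V + mass f W := by
  refine mass_le f fun g hg h0 => ?_
  refine le_of_forall_pos_le_add fun e he => ?_
  obtain ⟨η, hη, hlt⟩ := exists_pos_mul_lt he ‖f‖
  obtain ⟨K, hK, hKW, hKη⟩ := exists_isClopen_approx (hV.union hW) h0 hη
  -- `L` separates the part of `K` outside `W` from the complement of `V`, so `g` splits, up to `η`,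
  -- into a piece living in `V` and a piece on `K \ L ⊆ W`.
  obtain ⟨L, hL, h1, h2⟩ := exists_clopen_of_closed_subset_open (hK.isClosed.sdiff hW) hV
    fun x hx => (hKW hx.1).resolve_right hx.2
  have hM : IsClopen (K \ L) := hK.diff hL
  have hM2 : K \ L ⊆ W := fun x hx => by
    by_contra h
    exact hx.2 (h1 ⟨hx.1, h⟩)
  have hb : ∀ x, |g x| ≤ 1 := fun x => (g.norm_coe_le_norm x).trans hg
  have e1 : f (restrictClopen g hL) ≤ mass f V :=
    apply_le_mass f (norm_restrictClopen_le g hL zero_le_one fun x _ => hb x)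
      fun x hx => restrictClopen_apply_of_notMem g hL fun h => hx (h2 h)
  have e2 : f (restrictClopen g hM) ≤ mass f W :=
    apply_le_mass f (norm_restrictClopen_le g hM zero_le_one fun x _ => hb x)
      fun x hx => restrictClopen_apply_of_notMem g hM fun h => hx (hM2 h)
  have := apply_sub_le_of_norm_sub_le f (g := g) (h := restrictClopen g hL + restrictClopen g hM)
    hη.le fun x => by
    rw [ContinuousMap.add_apply]
    by_cases hx : x ∈ L
    · simpa [restrictClopen_apply_of_mem g hL hx,
        restrictClopen_apply_of_notMem g hM fun h => h.2 hx] using hη.le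
    · rw [restrictClopen_apply_of_notMem g hL hx, zero_add]
      by_cases hx' : x ∈ K
      · simpa [restrictClopen_apply_of_mem g hM ⟨hx', hx⟩] using hη.le
      · simpa [restrictClopen_apply_of_notMem g hM fun h => hx' h.1] using hKη x hx'
  rw [map_add] at this
  linarith

theorem mass_biUnion_le {ι : Type*} (f : StrongDual ℝ C(X, ℝ)) (s : Finset ι) {W : ι → Set X}
    (hW : ∀ i ∈ s, IsOpen (W i)) : mass f (⋃ i ∈ s, W i) ≤ ∑ i ∈ s, mass f (W i) := by
  classical
  induction s using Finset.induction_on with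
  | empty => simp [mass_empty]
  | insert i s hi ih =>
    rw [Finset.set_biUnion_insert, Finset.sum_insert hi]
    have hs : ∀ j ∈ s, IsOpen (W j) := fun j hj => hW j (Finset.mem_insert_of_mem hj)
    exact (mass_union_le f (hW i (Finset.mem_insert_self i s)) (isOpen_biUnion hs)).trans
      (add_le_add le_rfl (by simpa using ih hs))

/-- A functional is bounded on a function that is small on a finite set by its mass off that
set. -/
theorem abs_apply_le_mass_compl (f : StrongDual ℝ C(X, ℝ)) {F : Set X} {g : C(X, ℝ)}
    (hg : ‖g‖ ≤ 1) {η : ℝ} (hη : 0 ≤ η) (hF : IsClosed F) (hgF : ∀ x ∈ F, |g x| < η) :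
    |f g| ≤ ‖f‖ * η + mass f Fᶜ := by
  obtain ⟨K, hK, h1, h2⟩ := exists_clopen_of_closed_subset_open hF
    (isOpen_lt g.continuous.abs continuous_const : IsOpen {x | |g x| < η}) hgF
  have hsum : g = restrictClopen g hK + restrictClopen g hK.compl := by
    ext x
    rw [ContinuousMap.add_apply]
    by_cases hx : x ∈ K
    · rw [restrictClopen_apply_of_mem g hK hx,
        restrictClopen_apply_of_notMem g hK.compl fun h => h hx, add_zero]
    · rw [restrictClopen_apply_of_notMem g hK hx, restrictClopen_apply_of_mem g hK.compl hx,
        zero_add]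
  calc |f g| ≤ |f (restrictClopen g hK)| + |f (restrictClopen g hK.compl)| := by
        conv_lhs => rw [hsum, map_add]
        exact abs_add_le _ _
    _ ≤ ‖f‖ * η + mass f Fᶜ := by
        gcongr
        · exact f.le_of_opNorm_le_of_le le_rfl
            (norm_restrictClopen_le g hK hη fun x hx => (h2 hx).le)
        · exact abs_apply_le_mass f (norm_restrictClopen_le g _ zero_le_one fun x _ =>
            (g.norm_coe_le_norm x).trans hg) fun x hx => restrictClopen_apply_of_notMem g _
              fun h => hx fun h' => h (h1 h')

end Mass

/-! ### Rankings of closed sets, in the manner of Cantor–Bendixson rank. -/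

section Ranking

/-- The part of `F` on which the sets `W i`, `i < p`, are not shrunk by passing to `K i`. -/
def unshrunk {X : Type*} (F : Set X) (p : ℕ) (W K : ℕ → Set X) : Set X :=
  F \ ⋃ i ∈ Finset.range p, W i \ K i

variable {X : Type*}

theorem mem_unshrunk {F : Set X} {p : ℕ} {W K : ℕ → Set X} {x : X} :
    x ∈ unshrunk F p W K ↔ x ∈ F ∧ ∀ i < p, x ∈ W i → x ∈ K i := by
  simp only [unshrunk, Set.mem_sdiff, Set.mem_iUnion, Finset.mem_range, not_exists,
    not_and, not_not]

theorem compl_unshrunk (F : Set X) (p : ℕ) (W K : ℕ → Set X) :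
    (unshrunk F p W K)ᶜ = Fᶜ ∪ ⋃ i ∈ Finset.range p, W i \ K i := by
  rw [unshrunk, Set.sdiff_eq, Set.compl_inter, compl_compl]

variable [TopologicalSpace X]

/-- Every point of `F` is a strict local maximum of `r` on `F`. -/
def IsRanking (r : X → Ordinal.{0}) (F : Set X) : Prop :=
  ∀ x ∈ F, ∀ᶠ y in 𝓝 x, y ∈ F → y ≠ x → r y < r x

/-- `F` carries a ranking with values below `o`. -/
def HasRankBelow (F : Set X) (o : Ordinal.{0}) : Prop :=
  ∃ r : X → Ordinal.{0}, IsRanking r F ∧ ∀ x ∈ F, r x < o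

/-- Writing the set with an implication puts all of `Fᶜ` in it, so that it is open in `X` and not
merely in `F`. -/
theorem IsRanking.isOpen_lt {r : X → Ordinal.{0}} {F : Set X} (h : IsRanking r F)
    (hF : IsClosed F) (o : Ordinal.{0}) : IsOpen {x | x ∈ F → r x < o} := by
  rw [isOpen_iff_mem_nhds]
  intro x hx
  by_cases hxF : x ∈ F
  · filter_upwards [h x hxF] with y hy hyF
    by_cases hyx : y = x
    · rw [hyx]; exact hx hxF
    · exact (hy hyF hyx).trans (hx hxF)
  · filter_upwards [hF.isOpen_compl.mem_nhds hxF] with y hy hyF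
    exact absurd hyF hy

/-- Cutting a ranking of `F` into `p + 1` blocks of length `ω ^ γ`, by removing neighbourhoods of
the ends of the blocks, leaves a set of small rank. -/
theorem IsRanking.hasRankBelow_unshrunk {r : X → Ordinal.{0}} {F : Set X} (h : IsRanking r F)
    {o : Ordinal.{0}} (ho : o ≠ 0) {p : ℕ} (hp : ∀ x ∈ F, r x < o * ((p + 1 : ℕ) : Ordinal.{0}))
    {K : ℕ → Set X} (hK : ∀ i, IsClopen (K i))
    (hKW : ∀ i, K i ⊆ {x | x ∈ F → r x < o * ((i + 1 : ℕ) : Ordinal.{0})}) :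
    HasRankBelow
      (unshrunk F p (fun i => {x | x ∈ F → r x < o * ((i + 1 : ℕ) : Ordinal.{0})}) K) o := by
  -- The new rank is the position inside a block. It strictly drops near `x` because nearby unshrunk
  -- points of lower rank lie in the same block as `x`.
  refine ⟨fun x => r x % o, fun x hx => ?_, fun x _ => Ordinal.mod_lt _ ho⟩
  rw [mem_unshrunk] at hx
  have hlt : r x / o < ((p + 1 : ℕ) : Ordinal.{0}) :=
    (Ordinal.lt_mul_iff_div_lt ho).mp (hp x hx.1)
  obtain ⟨n, hn⟩ := Ordinal.lt_omega0.mp (hlt.trans (Ordinal.natCast_lt_omega0 _))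
  rw [hn, Nat.cast_lt] at hlt
  have hnr : o * n ≤ r x := by rw [← hn]; exact Ordinal.mul_div_le _ _
  have hlow : ∀ᶠ y in 𝓝 x, y ∈ unshrunk F p
      (fun i => {x | x ∈ F → r x < o * ((i + 1 : ℕ) : Ordinal.{0})}) K → o * n ≤ r y := by
    rcases n with _ | m
    · simp
    -- A point `y` near `x` avoids the closed set `K m`; being unshrunk, it then avoids the whole of
    -- `W m`, so it cannot fall into an earlier block.
    · have hxK : x ∉ K m := fun hxK => (hKW m hxK hx.1).not_ge hnr
      filter_upwards [(hK m).isClosed.isOpen_compl.mem_nhds hxK] with y hy hyH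
      rw [mem_unshrunk] at hyH
      by_contra! hc
      exact hy (hyH.2 m (by omega) fun _ => hc)
  filter_upwards [h x hx.1, hlow] with y hy1 hy2 hyH hyx
  have h1 := hy1 (mem_unshrunk.mp hyH).1 hyx
  have h2 : r y / o = n := by
    apply le_antisymm
    · rw [← hn]; exact Ordinal.div_le_left h1.le o
    · exact (Ordinal.mul_le_iff_le_div ho).mp (hy2 hyH)
  rw [← Ordinal.div_add_mod (r y) o, ← Ordinal.div_add_mod (r x) o, h2, hn] at h1
  exact lt_of_add_lt_add_left h1

theorem IsRanking.exists_le [CompactSpace X] {r : X → Ordinal.{0}} {F : Set X}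
    (h : IsRanking r F) (hF : IsClosed F) {o : Ordinal.{0}} (ho : o ≠ 0) (hr : ∀ x ∈ F, r x < o) :
    ∃ β < o, ∀ x ∈ F, r x ≤ β := by
  suffices H : ∃ β < o, ∀ x ∈ F, x ∈ F → r x ≤ β by
    obtain ⟨β, hβ, H⟩ := H
    exact ⟨β, hβ, fun x hx => H x hx hx⟩
  refine hF.isCompact.induction_on (p := fun s => ∃ β < o, ∀ x ∈ s, x ∈ F → r x ≤ β) ?_ ?_ ?_ ?_
  · exact ⟨0, pos_iff_ne_zero.mpr ho, by simp⟩
  · rintro s t hst ⟨β, hβ, H⟩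
    exact ⟨β, hβ, fun x hx => H x (hst hx)⟩
  · rintro s t ⟨β, hβ, H⟩ ⟨β', hβ', H'⟩
    refine ⟨max β β', max_lt hβ hβ', ?_⟩
    rintro x (hx | hx) hxF
    · exact (H x hx hxF).trans (le_max_left _ _)
    · exact (H' x hx hxF).trans (le_max_right _ _)
  · intro x hx
    refine ⟨{y | y ∈ F → r y ≤ r x}, mem_nhdsWithin_of_mem_nhds ?_, r x, hr x hx, fun y hy => hy⟩
    filter_upwards [h x hx] with y hy hyF
    by_cases hyx : y = x
    · rw [hyx]
    · exact (hy hyF hyx).le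

theorem HasRankBelow.finite [CompactSpace X] {F : Set X} (h : HasRankBelow F 1)
    (hF : IsClosed F) : F.Finite := by
  obtain ⟨r, hr, h1⟩ := h
  rw [← Set.inter_self F]
  refine hF.isCompact.induction_on (p := fun s => (F ∩ s).Finite) (by simp)
    (fun s t hst ht => ht.subset (Set.inter_subset_inter_right _ hst))
    (fun s t hs ht => by rw [Set.inter_union_distrib_left]; exact hs.union ht) fun x hx => ?_
  refine ⟨{y | y ∈ F → y ≠ x → r y < r x}, mem_nhdsWithin_of_mem_nhds (hr x hx),
    (Set.finite_singleton x).subset ?_⟩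
  rintro y ⟨hyF, hy⟩
  by_contra hyx
  have := hy hyF hyx
  rw [Order.lt_one_iff.mp (h1 x hx)] at this
  exact not_lt_zero this

end Ranking

/-! ### Upper bound: derivation consumes mass. -/

section UpperBound

variable {X : Type*} [TopologicalSpace X]

/-- Sequentially weak*-open sets of functionals. -/
def IsSeqWeakStarOpen (V : Set (StrongDual ℝ C(X, ℝ))) : Prop :=
  ∀ b ∈ V, ∀ f : ℕ → StrongDual ℝ C(X, ℝ), (∀ g, Tendsto (fun n => f n g) atTop (𝓝 (b g))) →
    ∀ᶠ n in atTop, f n ∈ V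

theorem IsSeqWeakStarOpen.inter_lt_sum {V : Set (StrongDual ℝ C(X, ℝ))} (hV : IsSeqWeakStarOpen V)
    (p : ℕ) (g : ℕ → C(X, ℝ)) (t : ℝ) :
    IsSeqWeakStarOpen (V ∩ {f | t < ∑ i ∈ Finset.range p, f (g i)}) := by
  intro b hb f hf
  refine (hV b hb.1 f hf).and ?_
  exact (tendsto_finsetSum (Finset.range p) fun i _ => hf (g i)).eventually_const_lt hb.2

variable [CompactSpace X]

/-- The iterated Szlenk derivations of the dual unit ball of `C(X, ℝ)`. -/
noncomputable def ballSzlenk (X : Type*) [TopologicalSpace X] [CompactSpace X] (ε : ℝ)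
    (α : Ordinal.{0}) : Set (StrongDual ℝ C(X, ℝ)) :=
  szlenkSet ε (Metric.closedBall 0 1) (Metric.closedBall 0 1) α

theorem ballSzlenk_antitone (ε : ℝ) : Antitone (ballSzlenk X ε) := szlenkSet_antitone _ _ _

theorem norm_le_one_of_mem_ballSzlenk {ε : ℝ} {α : Ordinal.{0}} {f : StrongDual ℝ C(X, ℝ)}
    (hf : f ∈ ballSzlenk X ε α) : ‖f‖ ≤ 1 := by
  have := ballSzlenk_antitone ε (zero_le : 0 ≤ α) hf
  rw [ballSzlenk, szlenkSet_zero] at this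
  exact mem_closedBall_zero_iff.mp this

variable [T2Space X] [TotallyDisconnectedSpace X]

theorem exists_isClopen_lt_sum (f : StrongDual ℝ C(X, ℝ)) {p : ℕ} {W : ℕ → Set X}
    (hW : ∀ i, IsOpen (W i)) {t : ℝ} (ht : t < ∑ i ∈ Finset.range p, mass f (W i)) :
    ∃ (K : ℕ → Set X) (g : ℕ → C(X, ℝ)), (∀ i, IsClopen (K i)) ∧ (∀ i, K i ⊆ W i) ∧
      (∀ i, ‖g i‖ ≤ 1) ∧ (∀ i, ∀ x ∉ K i, g i x = 0) ∧ t < ∑ i ∈ Finset.range p, f (g i) := by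
  obtain ⟨η, hη, hlt⟩ := exists_pos_mul_lt (sub_pos.mpr ht) p
  choose K hK hKW g hg h0 hgt using fun i =>
    exists_isClopen_lt_apply f (hW i) (sub_lt_self (mass f (W i)) hη)
  refine ⟨K, g, hK, hKW, hg, h0, ?_⟩
  have : ∑ i ∈ Finset.range p, (mass f (W i) - η) ≤ ∑ i ∈ Finset.range p, f (g i) :=
    Finset.sum_le_sum fun i _ => (hgt i).le
  rw [Finset.sum_sub_distrib, Finset.sum_const, Finset.card_range, nsmul_eq_mul] at this
  linarith

theorem mass_compl_unshrunk_le (f : StrongDual ℝ C(X, ℝ)) {F : Set X} (hF : IsClosed F) (p : ℕ)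
    {W K : ℕ → Set X} (hW : ∀ i, IsOpen (W i)) (hK : ∀ i, IsClopen (K i)) (hKW : ∀ i, K i ⊆ W i) :
    mass f (unshrunk F p W K)ᶜ ≤ mass f Fᶜ +
      (∑ i ∈ Finset.range p, mass f (W i) - ∑ i ∈ Finset.range p, mass f (K i)) := by
  have hO : ∀ i, IsOpen (W i \ K i) := fun i => (hW i).sdiff (hK i).isClosed
  rw [compl_unshrunk, ← Finset.sum_sub_distrib]
  refine (mass_union_le f hF.isOpen_compl (isOpen_biUnion fun i _ => hO i)).trans
    (add_le_add le_rfl ((mass_biUnion_le f _ fun i _ => hO i).trans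
      (Finset.sum_le_sum fun i _ => ?_)))
  linarith [mass_sdiff_add_le f (hKW i)]

/-- A functional obtained by one derivation step is approximated by functionals having mass
almost `ε` off any given finite set. -/
theorem not_mem_add_one_of_mass_compl_le {ε δ : ℝ} (hδ : 0 < δ) {V : Set (StrongDual ℝ C(X, ℝ))}
    (hV : IsSeqWeakStarOpen V) {F : Set X} (hF : F.Finite) {α : Ordinal.{0}}
    (hoff : ∀ f ∈ V ∩ ballSzlenk X ε α, mass f Fᶜ ≤ ε - δ) {b : StrongDual ℝ C(X, ℝ)}
    (hb : b ∈ V) : b ∉ ballSzlenk X ε (α + 1) := by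
  intro hbα
  rw [ballSzlenk, szlenkSet_add_one] at hbα
  obtain ⟨-, a, f, ha, hf, hfb, ⟨L, hL, hlim⟩, ha0⟩ := hbα
  rw [tendsto_toWeakDual_iff] at hfb
  rw [tendsto_toWeakSpace_iff] at ha0
  have h1 : ∀ᶠ n in atTop, ∀ x ∈ F, |a n x| < δ / 2 := by
    refine (Set.Finite.eventually_all hF).mpr fun x _ => ?_
    have := (ha0 (ContinuousMap.evalCLM ℝ x)).abs
    simp only [map_zero, abs_zero] at this
    exact this.eventually_lt_const (half_pos hδ)
  have h2 : ∀ᶠ n in atTop, f n (a n) ≤ ε - δ / 2 := by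
    filter_upwards [h1, hV b hb f hfb] with n h1 h2
    have hn : ‖f n‖ ≤ 1 := norm_le_one_of_mem_ballSzlenk (hf n)
    have h3 := abs_apply_le_mass_compl (f n) (by simpa using ha n) (half_pos hδ).le
      hF.isClosed h1
    have h4 := hoff (f n) ⟨h2, hf n⟩
    have h5 := le_abs_self (f n (a n))
    nlinarith
  have := le_of_tendsto hlim h2
  linarith

/-- Induction on `γ`. If the sum at `b` exceeds `t > c - δ`, clopen `K i ⊆ W i` and test functions
on them witness this, and they do so on a sequentially weak*-open set around `b`. There the mass
lost between `W i` and `K i` totals less than `c - t`, so the mass off the unshrunk set is at most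
`ε - δ'` with `δ' = t - (c - δ)`. That set has rank below `ω ^ γ`. It is finite if `γ = 0`, which
one derivation step rules out; otherwise the induction hypothesis applies to it at a lower exponent.
-/
theorem sum_mass_le_sub {ε : ℝ} (γ : Ordinal.{0}) : ∀ {δ c : ℝ}, 0 < δ →
    ∀ {V : Set (StrongDual ℝ C(X, ℝ))}, IsSeqWeakStarOpen V → ∀ {F : Set X}, IsClosed F →
    ∀ {p : ℕ} {W : ℕ → Set X}, (∀ i, IsOpen (W i)) →
    (∀ K : ℕ → Set X, (∀ i, IsClopen (K i)) → (∀ i, K i ⊆ W i) →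
      HasRankBelow (unshrunk F p W K) (ω ^ γ)) →
    ∀ {α : Ordinal.{0}}, (∀ f ∈ V ∩ ballSzlenk X ε α, mass f Fᶜ ≤ ε - δ) →
    (∀ f ∈ V ∩ ballSzlenk X ε α, ∑ i ∈ Finset.range p, mass f (W i) ≤ c) →
    ∀ f ∈ V ∩ ballSzlenk X ε (α + ω ^ γ), ∑ i ∈ Finset.range p, mass f (W i) ≤ c - δ := by
  induction γ using WellFoundedLT.induction with
  | ind γ ih =>
  intro δ c hδ V hV F hF p W hW hgood α hoff hc b hb
  by_contra! hlt
  obtain ⟨t, ht, htb⟩ := exists_between hlt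
  obtain ⟨K, g, hK, hKW, hg, hgK, hgt⟩ := exists_isClopen_lt_sum b hW htb
  have hδ' : 0 < t - (c - δ) := sub_pos.mpr ht
  have hV' := hV.inter_lt_sum p g t
  set V' := V ∩ {f | t < ∑ i ∈ Finset.range p, f (g i)} with hV'def
  have hbV' : b ∈ V' := ⟨hb.1, hgt⟩
  have hF' : IsClosed (unshrunk F p W K) :=
    hF.sdiff (isOpen_biUnion fun i _ => (hW i).sdiff (hK i).isClosed)
  have hoff' : ∀ f ∈ V' ∩ ballSzlenk X ε α,
      mass f (unshrunk F p W K)ᶜ ≤ ε - (t - (c - δ)) := by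
    rintro f ⟨⟨hfV, hft⟩, hfα⟩
    have h1 := mass_compl_unshrunk_le f hF p hW hK hKW
    have h2 := hoff f ⟨hfV, hfα⟩
    have h3 := hc f ⟨hfV, hfα⟩
    have h4 : ∑ i ∈ Finset.range p, f (g i) ≤ ∑ i ∈ Finset.range p, mass f (K i) :=
      Finset.sum_le_sum fun i _ => apply_le_mass f (hg i) (hgK i)
    have h5 : t < ∑ i ∈ Finset.range p, f (g i) := hft
    linarith
  have hrank := hgood K hK hKW
  rcases eq_or_ne γ 0 with rfl | hγ
  · rw [Ordinal.opow_zero] at hrank hb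
    exact not_mem_add_one_of_mass_compl_le hδ' hV' (hrank.finite hF') hoff' hbV' hb.2
  · obtain ⟨r, hr, hrγ⟩ := hrank
    obtain ⟨β, hβ, hrβ⟩ := hr.exists_le hF' (Ordinal.opow_pos _ Ordinal.omega0_pos).ne' hrγ
    have hγ' : Ordinal.log ω β < γ :=
      (Ordinal.lt_opow_iff_log_lt' Ordinal.one_lt_omega0 hγ).mp hβ
    set γ' := Ordinal.log ω β
    have hβ' : β < ω ^ γ' * ω := by
      rw [← Ordinal.opow_succ]
      exact Ordinal.lt_opow_succ_log_self Ordinal.one_lt_omega0 β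
    obtain ⟨_, hq, hβq⟩ := (Ordinal.lt_mul_iff_of_isSuccLimit Ordinal.isSuccLimit_omega0).mp hβ'
    obtain ⟨q, rfl⟩ := Ordinal.lt_omega0.mp hq
    -- Cutting at `q` levels produces `q + 1` blocks, hence the weakened bound.
    have hrq : ∀ x ∈ unshrunk F p W K, r x < ω ^ γ' * ((q + 1 : ℕ) : Ordinal.{0}) := fun x hx =>
      ((hrβ x hx).trans_lt hβq).trans_le (by gcongr; simp)
    -- Each further `ω ^ γ'` steps cost another `δ'`, starting from the trivial bound `q`. Since `γ'
    -- < γ`, any finite number of such rounds fits in `ω ^ γ`, and the bound becomes negative.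
    have hiter : ∀ M : ℕ, ∀ f ∈ V' ∩ ballSzlenk X ε (α + ω ^ γ' * M),
        ∑ i ∈ Finset.range q, mass f
          {x | x ∈ unshrunk F p W K → r x < ω ^ γ' * ((i + 1 : ℕ) : Ordinal.{0})} ≤
          q - M * (t - (c - δ)) := by
      intro M
      induction M with
      | zero =>
        rintro f ⟨-, hf⟩
        refine (Finset.sum_le_sum fun i _ => (mass_le_norm f _).trans
          (norm_le_one_of_mem_ballSzlenk hf)).trans ?_
        simp
      | succ M ihM =>
        have := ih γ' hγ' hδ' hV' hF' (fun i => hr.isOpen_lt hF' _)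
          (fun K' hK' hKW' => hr.hasRankBelow_unshrunk
            (Ordinal.opow_pos _ Ordinal.omega0_pos).ne' hrq hK' hKW')
          (fun f hf => hoff' f ⟨hf.1, ballSzlenk_antitone ε le_self_add hf.2⟩) ihM
        intro f hf
        refine (this f ?_).trans_eq (by push_cast; ring)
        rwa [Nat.cast_succ, mul_add_one, ← add_assoc] at hf
    obtain ⟨M, hM⟩ := exists_nat_gt ((q : ℝ) / (t - (c - δ)))
    rw [div_lt_iff₀ hδ'] at hM
    have hMγ : ω ^ γ' * (M : Ordinal.{0}) ≤ ω ^ γ := by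
      calc ω ^ γ' * (M : Ordinal.{0}) ≤ ω ^ γ' * ω := by
            gcongr; exact (Ordinal.natCast_lt_omega0 M).le
        _ = ω ^ Order.succ γ' := (Ordinal.opow_succ _ _).symm
        _ ≤ ω ^ γ := Ordinal.opow_le_opow_right Ordinal.omega0_pos (Order.succ_le_of_lt hγ')
    have h1 := hiter M b ⟨hbV', ballSzlenk_antitone ε (by gcongr) hb.2⟩
    have h2 : (0 : ℝ) ≤ ∑ i ∈ Finset.range q, mass b
        {x | x ∈ unshrunk F p W K → r x < ω ^ γ' * ((i + 1 : ℕ) : Ordinal.{0})} :=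
      Finset.sum_nonneg fun i _ => mass_nonneg b _
    linarith

/-- If `X` has a ranking with values at most `ω ^ γ * k`, and this value is taken at most at
`x₀`, then the Szlenk derivation of the dual ball of `C(X)` stops soon after
`ω ^ γ * N` steps, when `k < (N + 1) * ε`. -/
theorem ballSzlenk_eq_empty {ε : ℝ} (hε : 0 < ε) {γ : Ordinal.{0}} {k N : ℕ}
    (hN : (k : ℝ) < (N + 1) * ε) {r : X → Ordinal.{0}} (hr : IsRanking r Set.univ)
    {x₀ : X} (hr₀ : r x₀ ≤ ω ^ γ * k) (hlt : ∀ x ≠ x₀, r x < ω ^ γ * k) :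
    ballSzlenk X ε (ω ^ γ * N + 1) = ∅ := by
  have hV : IsSeqWeakStarOpen (Set.univ : Set (StrongDual ℝ C(X, ℝ))) := by
    intro b _ f _; simp
  have hrk : ∀ x ∈ (Set.univ : Set X), r x < ω ^ γ * ((k + 1 : ℕ) : Ordinal.{0}) := by
    intro x _
    refine (?_ : r x ≤ ω ^ γ * k).trans_lt ?_
    · by_cases hx : x = x₀
      · rw [hx]; exact hr₀
      · exact (hlt x hx).le
    · rw [Nat.cast_succ, mul_add_one]
      exact lt_add_of_pos_right _ (Ordinal.opow_pos _ Ordinal.omega0_pos)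
  set W : ℕ → Set X :=
    fun i => {x | x ∈ Set.univ → r x < ω ^ γ * ((i + 1 : ℕ) : Ordinal.{0})} with hWdef
  have hiter : ∀ M : ℕ, ∀ f ∈ Set.univ ∩ ballSzlenk X ε (ω ^ γ * M),
      ∑ i ∈ Finset.range k, mass f (W i) ≤ k - M * ε := by
    intro M
    induction M with
    | zero =>
      rintro f ⟨-, hf⟩
      refine (Finset.sum_le_sum fun i _ => (mass_le_norm f _).trans
        (norm_le_one_of_mem_ballSzlenk hf)).trans ?_
      simp
    | succ M ih =>
      have := sum_mass_le_sub γ hε hV isClosed_univ (fun i => hr.isOpen_lt isClosed_univ _)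
        (fun K' hK' hKW' => hr.hasRankBelow_unshrunk
          (Ordinal.opow_pos _ Ordinal.omega0_pos).ne' hrk hK' hKW')
        (fun f hf => by simp [mass_empty]) ih
      intro f hf
      refine (this f ?_).trans_eq (by push_cast; ring)
      rwa [Nat.cast_succ, mul_add_one] at hf
  -- The second entry is the deficit `ε - (k - N * ε)`; the first serves `k = 0`, where the space is
  -- the single point `x₀`.
  have hpos : 0 < min ε ((N + 1) * ε - k) := lt_min hε (sub_pos.mpr hN)
  refine Set.eq_empty_of_forall_notMem fun b => not_mem_add_one_of_mass_compl_le hpos hV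
    (Set.finite_singleton x₀) (fun f hf => ?_) (Set.mem_univ b)
  rcases k with _ | k
  · have : (∅ : Set X) = {x₀}ᶜ := by
      ext x
      simpa using fun hx => (hlt x hx)
    rw [← this, mass_empty]
    linarith [min_le_left ε ((N + 1) * ε - (0 : ℕ))]
  · have h1 : mass f {x₀}ᶜ ≤ mass f (W k) := mass_mono f fun x hx _ => hlt x hx
    have h2 : mass f (W k) ≤ ∑ i ∈ Finset.range (k + 1), mass f (W i) :=
      Finset.single_le_sum (fun i _ => mass_nonneg f (W i)) (Finset.self_mem_range_succ k)
    have h3 := hiter N f hf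
    have h4 := min_le_right ε ((N + 1) * ε - (k + 1 : ℕ))
    linarith

end UpperBound

/-! ### Cantor normal form and approximating sequences in `[1, α]`. -/

section OrdinalInterval

instance : TotallyDisconnectedSpace Ordinal.{0} := by
  have : TotallySeparatedSpace Ordinal.{0} := by
    refine totallySeparatedSpace_iff_exists_isClopen.mpr fun x y hxy => ?_
    have hcl : ∀ z : Ordinal.{0}, IsClopen (Set.Iic z) := fun z =>
      ⟨isClosed_Iic, by rw [← Order.Iio_succ]; exact isOpen_Iio⟩
    rcases hxy.lt_or_gt with h | h
    · exact ⟨Set.Iic x, hcl x, Set.self_mem_Iic, h.not_ge⟩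
    · exact ⟨(Set.Iic y)ᶜ, (hcl y).compl, h.not_ge, fun hy => hy Set.self_mem_Iic⟩
  infer_instance

theorem exists_eq_opow_mul_add_one {x : Ordinal.{0}} (hx : x ≠ 0) :
    ∃ e q : Ordinal.{0}, x = ω ^ e * (q + 1) := by
  induction x using WellFoundedLT.induction with
  | ind x ih =>
  set l := Ordinal.log ω x
  have hx' := Ordinal.div_add_mod x (ω ^ l)
  obtain ⟨d, hd⟩ := Ordinal.lt_omega0.mp (Ordinal.div_opow_log_lt x Ordinal.one_lt_omega0)
  have hlt : x % ω ^ l < ω ^ l := Ordinal.mod_lt _ (Ordinal.opow_pos _ Ordinal.omega0_pos).ne'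
  by_cases hm : x % ω ^ l = 0
  · rw [hm, add_zero] at hx'
    rcases d with _ | d
    · rw [hd, Nat.cast_zero, mul_zero] at hx'
      exact absurd hx'.symm hx
    · exact ⟨l, d, by rw [← hx', hd, Nat.cast_succ]⟩
  · obtain ⟨e, q, he⟩ := ih (x % ω ^ l) (Ordinal.mod_opow_log_lt_self ω hx) hm
    have hel : e ≤ l := by
      refine (Ordinal.opow_lt_opow_iff_right Ordinal.one_lt_omega0).mp (lt_of_le_of_lt ?_ hlt) |>.le
      rw [he]
      exact le_mul_of_one_le_right' (by simp)
    -- The remainder supplies the last term; as `e ≤ l`, the factor `ω ^ e` comes out of the leading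
    -- term too.
    refine ⟨e, ω ^ (l - e) * (x / ω ^ l) + q, ?_⟩
    rw [add_assoc, mul_add, ← he, ← mul_assoc, ← Ordinal.opow_add, Ordinal.add_sub_cancel_of_le hel,
      hx']

/-- For `x = ω ^ e * (q + 1)` the rank is `e`: no multiple of `ω ^ e` lies strictly between `ω ^ e *
q` and `x`, so points there have smaller exponent. -/
theorem exists_isRanking_Icc (α : Ordinal.{0}) :
    ∃ r : Set.Icc (1 : Ordinal.{0}) α → Ordinal.{0}, IsRanking r Set.univ ∧
      ∀ x, ω ^ r x ≤ (x : Ordinal.{0}) := by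
  choose r q h using fun x : Set.Icc (1 : Ordinal.{0}) α =>
    exists_eq_opow_mul_add_one (Order.one_le_iff_ne_zero.mp x.2.1)
  refine ⟨r, fun x _ => ?_, fun x => ?_⟩
  · have hq : ω ^ r x * q x < (x : Ordinal.{0}) := by
      conv_rhs => rw [h x]
      rw [mul_add_one]
      exact lt_add_of_pos_right _ (Ordinal.opow_pos _ Ordinal.omega0_pos)
    have hnhds : ∀ᶠ y : Set.Icc (1 : Ordinal.{0}) α in 𝓝 x,
        ω ^ r x * q x < (y : Ordinal.{0}) ∧ (y : Ordinal.{0}) < x + 1 :=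
      (continuous_subtype_val.tendsto x).eventually
        ((eventually_gt_nhds hq).and (eventually_lt_nhds (lt_add_one _)))
    filter_upwards [hnhds] with y hy _ hyx
    by_contra! hr
    have hyx' : (y : Ordinal.{0}) < ω ^ r x * (q x + 1) := by
      rw [← h x]
      exact lt_of_le_of_ne (Order.lt_add_one_iff.mp hy.2) fun e => hyx (Subtype.ext e)
    obtain ⟨s, hs⟩ : ω ^ r x ∣ (y : Ordinal.{0}) := by
      rw [h y]
      exact (Ordinal.opow_dvd_opow ω hr).mul_right _
    have hy1 := hy.1
    rw [hs] at hy1 hyx'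
    have h1 := lt_of_mul_lt_mul_left' hy1
    have h2 := lt_of_mul_lt_mul_left' hyx'
    exact (Order.add_one_le_of_lt h1).not_gt h2
  · conv_rhs => rw [h x]
    exact le_mul_of_one_le_right' (by simp)

theorem countable_Iio_of_lt_omega_one {o : Ordinal.{0}} (ho : o < ω_ 1) :
    (Set.Iio o).Countable := by
  rw [← Cardinal.le_aleph0_iff_set_countable, Cardinal.mk_Iio_ordinal, Cardinal.lift_le_aleph0,
    ← Order.lt_succ_iff, Cardinal.succ_aleph0, ← Cardinal.lt_ord, Cardinal.ord_aleph]
  exact ho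

theorem opow_lt_omega_one {e : Ordinal.{0}} (he : e < ω_ 1) : ω ^ e < ω_ 1 :=
  Ordinal.isPrincipal_opow_omega 1 Ordinal.omega0_lt_omega_one he

theorem exists_strictMono_cofinal {o : Ordinal.{0}} (ho : o < ω_ 1) (hl : Order.IsSuccLimit o) :
    ∃ t : ℕ → Ordinal.{0}, StrictMono t ∧ (∀ n, t n < o) ∧ (∀ n, 1 ≤ t n) ∧
      ∀ a < o, ∃ n, a < t n := by
  obtain ⟨e, he⟩ := (countable_Iio_of_lt_omega_one ho).exists_eq_range ⟨0, hl.bot_lt⟩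
  have hlt : ∀ n, e n < o := fun n => (he ▸ Set.mem_range_self n : e n ∈ Set.Iio o)
  let t : ℕ → Ordinal.{0} := fun n => Nat.rec 1 (fun n s => max s (e n) + 1) n
  have hts : ∀ n, t (n + 1) = max (t n) (e n) + 1 := fun n => rfl
  have hmono : StrictMono t := strictMono_nat_of_lt_succ fun n => by
    rw [hts]
    exact Order.lt_add_one_iff.mpr (le_max_left _ _)
  refine ⟨t, hmono, fun n => ?_, fun n => hmono.monotone (Nat.zero_le n), fun a ha => ?_⟩
  · induction n with
    | zero => exact Ordinal.one_lt_of_isSuccLimit hl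
    | succ n ih =>
      rw [hts]
      exact hl.add_one_lt (max_lt ih (hlt n))
  · obtain ⟨n, rfl⟩ : a ∈ Set.range e := he ▸ ha
    exact ⟨n + 1, by rw [hts]; exact Order.lt_add_one_iff.mpr (le_max_right _ _)⟩

/-- With `x = ω ^ ρ * (ω * s)`, take `y n = ω ^ ρ * t n` for `t n` increasing to `ω * s`; the `A n`
are the successive intervals ending at `y n`. -/
theorem exists_seq_tendsto_of_dvd {α : Ordinal.{0}} (hα : α < ω_ 1) {ρ : Ordinal.{0}}
    (x : Set.Icc (1 : Ordinal.{0}) α) (hx : ω ^ (ρ + 1) ∣ (x : Ordinal.{0})) :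
    ∃ (y : ℕ → Set.Icc (1 : Ordinal.{0}) α) (A : ℕ → Set (Set.Icc (1 : Ordinal.{0}) α)),
      Tendsto y atTop (𝓝 x) ∧ (∀ n, ω ^ ρ ∣ (y n : Ordinal.{0})) ∧ (∀ n, IsClopen (A n)) ∧
      Pairwise (Function.onFun Disjoint A) ∧ ∀ n, y n ∈ A n := by
  obtain ⟨s, hs⟩ := hx
  rw [Ordinal.opow_add, Ordinal.opow_one, mul_assoc] at hs
  have hpos : (0 : Ordinal.{0}) < ω ^ ρ := Ordinal.opow_pos _ Ordinal.omega0_pos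
  have hs0 : 0 < s := by
    rw [pos_iff_ne_zero]
    rintro rfl
    rw [mul_zero, mul_zero] at hs
    exact Order.one_le_iff_ne_zero.mp x.2.1 hs
  have hl : Order.IsSuccLimit (ω * s) := Ordinal.isSuccLimit_mul_left Ordinal.isSuccLimit_omega0 hs0
  have hle : ω * s ≤ (x : Ordinal.{0}) := by
    rw [hs]; exact Ordinal.le_mul_right _ hpos
  obtain ⟨t, hmono, hlt, h1, hcof⟩ :=
    exists_strictMono_cofinal ((hle.trans x.2.2).trans_lt hα) hl
  have hyx : ∀ n, ω ^ ρ * t n < x := fun n => by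
    rw [hs]; exact mul_lt_mul_of_pos_left (hlt n) hpos
  have hymono : StrictMono fun n => ω ^ ρ * t n := fun m n h =>
    mul_lt_mul_of_pos_left (hmono h) hpos
  let y : ℕ → Set.Icc (1 : Ordinal.{0}) α := fun n => ⟨ω ^ ρ * t n,
    (h1 n).trans (Ordinal.le_mul_right _ hpos), (hyx n).le.trans x.2.2⟩
  have hclopen : ∀ z : Ordinal.{0},
      IsClopen {w : Set.Icc (1 : Ordinal.{0}) α | (w : Ordinal.{0}) ≤ z} := fun z =>
    IsClopen.preimage ⟨isClosed_Iic, by rw [← Order.Iio_succ]; exact isOpen_Iio⟩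
      continuous_subtype_val
  have hdisj : Pairwise (Function.onFun Disjoint (disjointed fun n =>
      {w : Set.Icc (1 : Ordinal.{0}) α | (w : Ordinal.{0}) ≤ ω ^ ρ * t n})) :=
    disjoint_disjointed _
  refine ⟨y, _, ?_, fun n => Dvd.intro _ rfl, fun n => ?_, hdisj, fun n => ?_⟩
  · rw [tendsto_subtype_rng]
    refine tendsto_order.mpr ⟨fun a ha => ?_, fun a ha => Eventually.of_forall fun n =>
      (hyx n).trans ha⟩
    rw [hs, Ordinal.lt_mul_iff_of_isSuccLimit hl] at ha
    obtain ⟨c, hc, hac⟩ := ha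
    obtain ⟨N, hN⟩ := hcof c hc
    filter_upwards [eventually_ge_atTop N] with n hn
    exact hac.trans_le (mul_le_mul_right (hN.le.trans (hmono.monotone hn)) _)
  · exact disjointedRec (fun _ _ h => h.diff (hclopen _)) (hclopen _)
  · rw [disjointed_eq_inter_compl]
    refine ⟨(le_rfl : ω ^ ρ * t n ≤ ω ^ ρ * t n), ?_⟩
    simp only [Set.mem_iInter]
    exact fun m hm h => (hymono hm).not_ge h

end OrdinalInterval

/-! ### Lower bound: moving atoms of a discrete measure. -/

section LowerBound

variable {X : Type*} [TopologicalSpace X] {ι : Type*}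

/-- The number of the first `t` groups to which `i` belongs. -/
def groupCount [DecidableEq ι] (J : ℕ → Finset ι) (t : ℕ) (i : ι) : ℕ :=
  ((Finset.range t).filter fun s => i ∈ J s).card

theorem groupCount_succ [DecidableEq ι] (J : ℕ → Finset ι) (t : ℕ) (i : ι) :
    groupCount J (t + 1) i = groupCount J t i + if i ∈ J t then 1 else 0 := by
  rw [groupCount, groupCount, Finset.range_add_one, Finset.filter_insert]
  split_ifs with h
  · rw [Finset.card_insert_of_notMem (by simp)]
  · rfl

variable [Fintype ι]

/-- The measure `∑ i, m i • δ_{x i}` as a functional on `C(X, ℝ)`. -/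
noncomputable def diracSum (m : ι → ℝ) (x : ι → X) : StrongDual ℝ C(X, ℝ) :=
  ∑ i, m i • ContinuousMap.evalCLM ℝ (x i)

theorem diracSum_apply (m : ι → ℝ) (x : ι → X) (g : C(X, ℝ)) :
    diracSum m x g = ∑ i, m i * g (x i) := by
  simp [diracSum]

variable [CompactSpace X]

theorem diracSum_mem_closedBall {m : ι → ℝ} (hm : ∀ i, 0 ≤ m i) (h1 : ∑ i, m i ≤ 1) (x : ι → X) :
    diracSum m x ∈ Metric.closedBall (0 : StrongDual ℝ C(X, ℝ)) 1 := by
  refine (mem_closedBall_zero_iff (E := StrongDual ℝ C(X, ℝ))).mpr ?_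
  refine ContinuousLinearMap.opNorm_le_bound _ zero_le_one fun g => ?_
  rw [diracSum_apply]
  calc ‖∑ i, m i * g (x i)‖ ≤ ∑ i, m i * ‖g‖ := by
        refine norm_sum_le_of_le _ fun i _ => ?_
        rw [norm_mul, Real.norm_of_nonneg (hm i)]
        exact mul_le_mul_of_nonneg_left (g.norm_coe_le_norm _) (hm i)
    _ ≤ 1 * ‖g‖ := by
        rw [← Finset.sum_mul]
        exact mul_le_mul_of_nonneg_right h1 (norm_nonneg g)

variable [T2Space X] [TotallyDisconnectedSpace X]

/-- The test functions are indicators of `⋃ i ∈ J, A i n`. They equal `1` at the moving atoms and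
are weakly null, so the stationary atoms contribute nothing in the limit even if some `A i n`
contain them. -/
theorem diracSum_mem_add_one {ε : ℝ} {α : Ordinal.{0}} {m : ι → ℝ} (hm : ∀ i, 0 ≤ m i)
    (h1 : ∑ i, m i ≤ 1) {J : Finset ι} (hJ : ε ≤ ∑ i ∈ J, m i) {x : ι → X} {y : ι → ℕ → X}
    {A : ι → ℕ → Set X} (hyx : ∀ i ∈ J, Tendsto (y i) atTop (𝓝 (x i)))
    (hyJ : ∀ i ∉ J, ∀ n, y i n = x i) (hA : ∀ i ∈ J, ∀ n, IsClopen (A i n))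
    (hd : ∀ i ∈ J, Pairwise (Function.onFun Disjoint (A i))) (hyA : ∀ i ∈ J, ∀ n, y i n ∈ A i n)
    (hy : ∀ n, diracSum m (fun i => y i n) ∈ ballSzlenk X ε α) :
    diracSum m x ∈ ballSzlenk X ε (α + 1) := by
  classical
  have hU : ∀ n, IsClopen (⋃ i ∈ J, A i n) := fun n =>
    J.finite_toSet.isClopen_biUnion fun i hi => hA i hi n
  set a : ℕ → C(X, ℝ) := fun n => restrictClopen 1 (hU n) with ha
  have hnorm : ∀ n, ‖a n‖ ≤ 1 := fun n =>
    norm_restrictClopen_le 1 (hU n) zero_le_one fun x _ => by simp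
  have hweak : ∀ f : StrongDual ℝ C(X, ℝ), Tendsto (fun n => f (a n)) atTop (𝓝 0) := by
    intro f
    refine squeeze_zero_norm (a := fun n => ∑ i ∈ J, mass f (A i n)) (fun n => ?_) ?_
    · exact (abs_apply_le_mass f (hnorm n) fun x hx =>
        restrictClopen_apply_of_notMem 1 (hU n) hx).trans
          (mass_biUnion_le f J fun i hi => (hA i hi n).isOpen)
    · simpa using tendsto_finsetSum J fun i hi => tendsto_mass_of_disjoint f (hd i hi)
  rw [ballSzlenk, szlenkSet_add_one]
  refine ⟨diracSum_mem_closedBall hm h1 x, a, fun n => diracSum m fun i => y i n,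
    fun n => mem_closedBall_zero_iff.mpr (hnorm n), hy, ?_, ⟨∑ i ∈ J, m i, hJ, ?_⟩, ?_⟩
  · rw [tendsto_toWeakDual_iff]
    intro g
    simp only [diracSum_apply]
    refine tendsto_finsetSum _ fun i _ => Tendsto.const_mul _ ?_
    by_cases hi : i ∈ J
    · exact (g.continuous.tendsto _).comp (hyx i hi)
    · simp only [hyJ i hi]
      exact tendsto_const_nhds
  · simp only [diracSum_apply]
    rw [show ∑ i ∈ J, m i = ∑ i, m i * (if i ∈ J then 1 else 0) by simp]
    refine tendsto_finsetSum _ fun i _ => Tendsto.const_mul _ ?_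
    split_ifs with hi
    · refine tendsto_const_nhds.congr fun n => ?_
      rw [ha, restrictClopen_apply_of_mem 1 (hU n) (Set.mem_biUnion hi (hyA i hi n)),
        ContinuousMap.one_apply]
    · simp only [hyJ i hi]
      exact hweak (ContinuousMap.evalCLM ℝ (x i))
  · rw [tendsto_toWeakSpace_iff]
    simpa using hweak

/-- Exponents are controlled through divisibility, which passes to smaller exponents; this is what
handles limit stages. -/
theorem diracSum_mem_add [DecidableEq ι] {ω₀ : Ordinal.{0}} (hω₀ : ω₀ < ω_ 1) {ε : ℝ} {m : ι → ℝ}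
    (hm : ∀ i, 0 ≤ m i) (h1 : ∑ i, m i ≤ 1) {J : Finset ι} (hJ : ε ≤ ∑ i ∈ J, m i)
    {α : Ordinal.{0}} {e : ι → Ordinal.{0}}
    (h : ∀ x : ι → Set.Icc (1 : Ordinal.{0}) ω₀, (∀ i, ω ^ e i ∣ (x i : Ordinal.{0})) →
      diracSum m x ∈ ballSzlenk _ ε α) (β : Ordinal.{0}) :
    ∀ x : ι → Set.Icc (1 : Ordinal.{0}) ω₀,
      (∀ i, ω ^ (e i + if i ∈ J then β else 0) ∣ (x i : Ordinal.{0})) →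
      diracSum m x ∈ ballSzlenk _ ε (α + β) := by
  induction β using Ordinal.limitRecOn with
  | zero =>
    intro x hx
    rw [add_zero]
    exact h x fun i => by simpa using hx i
  | add_one β ih =>
    intro x hx
    have hex : ∀ i, ∃ (y : ℕ → Set.Icc (1 : Ordinal.{0}) ω₀)
        (A : ℕ → Set (Set.Icc (1 : Ordinal.{0}) ω₀)),
        (∀ n, ω ^ (e i + if i ∈ J then β else 0) ∣ (y n : Ordinal.{0})) ∧
        (i ∉ J → ∀ n, y n = x i) ∧ (i ∈ J → Tendsto y atTop (𝓝 (x i)) ∧ (∀ n, IsClopen (A n)) ∧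
        Pairwise (Function.onFun Disjoint A) ∧ ∀ n, y n ∈ A n) := by
      intro i
      by_cases hi : i ∈ J
      · have hxi := hx i
        rw [if_pos hi, ← add_assoc] at hxi
        obtain ⟨y, A, h1, h2, h3⟩ := exists_seq_tendsto_of_dvd hω₀ (x i) hxi
        exact ⟨y, A, by simpa [hi] using h2, fun h => absurd hi h, fun _ => ⟨h1, h3⟩⟩
      · exact ⟨fun _ => x i, fun _ => ∅, fun _ => by simpa [hi] using hx i, fun _ _ => rfl,
          fun h => absurd h hi⟩
    choose y A hyd hyJ hyA using hex
    rw [← add_assoc]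
    exact diracSum_mem_add_one hm h1 hJ (fun i hi => (hyA i hi).1) hyJ (fun i hi => (hyA i hi).2.1)
      (fun i hi => (hyA i hi).2.2.1) (fun i hi => (hyA i hi).2.2.2)
      fun n => ih (fun i => y i n) fun i => hyd i n
  | limit β hβ ih =>
    intro x hx
    rw [ballSzlenk, szlenkSet_limit _ _ _ (Ordinal.isSuccLimit_add α hβ)]
    simp only [Set.mem_iInter]
    intro δ hδ
    obtain ⟨β', hβ', hδβ⟩ := (Ordinal.lt_add_iff_of_isSuccLimit hβ).mp hδ
    refine ballSzlenk_antitone ε hδβ.le (ih β' hβ' x fun i => ?_)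
    refine (Ordinal.opow_dvd_opow ω ?_).trans (hx i)
    gcongr
    split_ifs
    · exact hβ'.le
    · exact le_rfl

theorem diracSum_mem_mul [DecidableEq ι] {ω₀ : Ordinal.{0}} (hω₀ : ω₀ < ω_ 1) {ε : ℝ} {m : ι → ℝ}
    (hm : ∀ i, 0 ≤ m i) (h1 : ∑ i, m i ≤ 1) {J : ℕ → Finset ι} (hJ : ∀ t, ε ≤ ∑ i ∈ J t, m i)
    (o : Ordinal.{0}) (t : ℕ) :
    ∀ x : ι → Set.Icc (1 : Ordinal.{0}) ω₀,
      (∀ i, ω ^ (o * (groupCount J t i : Ordinal.{0})) ∣ (x i : Ordinal.{0})) →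
      diracSum m x ∈ ballSzlenk _ ε (o * t) := by
  induction t with
  | zero =>
    intro x _
    rw [Nat.cast_zero, mul_zero, ballSzlenk, szlenkSet_zero]
    exact diracSum_mem_closedBall hm h1 x
  | succ t ih =>
    intro x hx
    rw [Nat.cast_succ, mul_add_one]
    refine diracSum_mem_add hω₀ hm h1 (hJ t) ih o x fun i => ?_
    have := hx i
    rw [groupCount_succ] at this
    split_ifs at this ⊢
    · rwa [Nat.cast_succ, mul_add_one] at this
    · simpa using this

theorem card_filter_val_lt {N k : ℕ} (hk : k ≤ N) :
    (Finset.univ.filter fun i : Fin N => i.val < k).card = k := by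
  rw [Fin.card_filter_val_lt, min_eq_right hk]

theorem ballSzlenk_nonempty {ω₀ o : Ordinal.{0}} (hω₀ : ω₀ < ω_ 1) {k N : ℕ} (hkN : k ≤ N)
    (hN : N ≠ 0) (hdvd : ω ^ (o * (k : Ordinal.{0})) ∣ ω₀) (h0 : ω₀ ≠ 0) {ε : ℝ}
    (hε : ε * N ≤ k) :
    (ballSzlenk (Set.Icc (1 : Ordinal.{0}) ω₀) ε (o * N)).Nonempty := by
  have : NeZero N := ⟨hN⟩
  have hNpos : (0 : ℝ) < N := by positivity
  -- `J t` is the cyclic window of length `k` starting at `t`; as `t` runs over a period, `i - t`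
  -- takes each value once, so `i` lies in at most `k` windows.
  let J : ℕ → Finset (Fin N) := fun t => Finset.univ.filter fun i => (i - Fin.ofNat N t).val < k
  have hcard : ∀ t, (J t).card = k := by
    intro t
    rw [← card_filter_val_lt hkN]
    refine Finset.card_bij (fun i _ => i - Fin.ofNat N t) (by simp [J])
      (fun i _ j _ h => sub_left_injective h) fun i hi => ⟨i + Fin.ofNat N t, ?_, by simp⟩
    simpa [J] using hi
  have hcount : ∀ i, groupCount J N i ≤ k := by
    intro i
    rw [groupCount]
    conv_rhs => rw [← card_filter_val_lt hkN]
    refine Finset.card_le_card_of_injOn (fun s => i - Fin.ofNat N s) (fun s hs => ?_) ?_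
    · simpa [J] using (Finset.mem_filter.mp hs).2
    · intro s hs t ht h
      simp only [Finset.coe_filter, Finset.mem_range, Set.mem_ofPred_eq] at hs ht
      have := congrArg Fin.val (sub_right_injective h)
      simpa [Fin.ofNat, Nat.mod_eq_of_lt hs.1, Nat.mod_eq_of_lt ht.1] using this
  refine ⟨_, diracSum_mem_mul hω₀ (ι := Fin N) (m := fun _ => 1 / (N : ℝ)) (fun _ => by positivity)
    ?_ (J := J) (fun t => ?_) o N
    (fun _ => ⟨ω₀, Order.one_le_iff_ne_zero.mpr h0, le_rfl⟩) fun i => ?_⟩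
  · simp [hNpos.ne']
  · rw [Finset.sum_const, hcard, nsmul_eq_mul, mul_one_div, le_div_iff₀ hNpos]
    exact hε
  · refine (Ordinal.opow_dvd_opow ω ?_).trans hdvd
    gcongr
    exact hcount i

end LowerBound

end SzlenkIndex

theorem mainTheorem5 (γ : Ordinal.{0}) (hγ : γ < ω_ 1) (k : ℕ) (ε : ℝ) (hε : 0 < ε)
    (hεk : ε ≤ 1 ∨ (k : ℝ) < ε) :
    SzlenkIndex.szlenkIndex ε
        (Metric.closedBall (0 : SzlenkIndex.COrd (ω ^ (ω ^ γ * (k : Ordinal.{0})))) 1)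
        (Metric.closedBall
          (0 : StrongDual ℝ (SzlenkIndex.COrd (ω ^ (ω ^ γ * (k : Ordinal.{0}))))) 1) =
      ω ^ γ * ((⌊(k : ℝ) / ε⌋₊ : ℕ) : Ordinal.{0}) + 1 := by
  have hωγ : ω ^ γ < ω_ 1 := SzlenkIndex.opow_lt_omega_one hγ
  have hmul : ∀ n : ℕ, ω ^ γ * (n : Ordinal.{0}) < ω_ 1 := fun n =>
    Ordinal.isPrincipal_mul_omega 1 hωγ
      ((Ordinal.natCast_lt_omega0 n).trans Ordinal.omega0_lt_omega_one)
  have hpos : 0 < ω ^ (ω ^ γ * (k : Ordinal.{0})) := Ordinal.opow_pos _ Ordinal.omega0_pos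
  refine SzlenkIndex.szlenkIndex_eq_add_one (hmul _) ?_ ?_
  · by_cases hN : ⌊(k : ℝ) / ε⌋₊ = 0
    · rw [hN, Nat.cast_zero, mul_zero, SzlenkIndex.szlenkSet_zero]
      exact ⟨0, Metric.mem_closedBall_self zero_le_one⟩
    · have hfl : (⌊(k : ℝ) / ε⌋₊ : ℝ) ≤ k / ε := Nat.floor_le (by positivity)
      have hε1 : ε ≤ 1 := by
        -- In the case `ε > k` the floor vanishes, so `ε ≤ 1` here. This gives `k ≤ N`, which the
        -- windows require.
        refine hεk.resolve_right fun h => hN (Nat.floor_eq_zero.mpr ?_)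
        rwa [div_lt_one hε]
      refine SzlenkIndex.ballSzlenk_nonempty (SzlenkIndex.opow_lt_omega_one (hmul k)) ?_ hN
        dvd_rfl hpos.ne' ?_
      · refine Nat.le_floor ?_
        rw [le_div_iff₀ hε]
        exact mul_le_of_le_one_right (Nat.cast_nonneg k) hε1
      · rwa [le_div_iff₀ hε, mul_comm] at hfl
  · obtain ⟨r, hr, hle⟩ := SzlenkIndex.exists_isRanking_Icc (ω ^ (ω ^ γ * (k : Ordinal.{0})))
    refine SzlenkIndex.ballSzlenk_eq_empty hε (k := k) ?_ hr
      (x₀ := ⟨_, Order.one_le_iff_ne_zero.mpr hpos.ne', le_rfl⟩) ?_ fun x hx => ?_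
    · rw [← div_lt_iff₀ hε]
      exact Nat.lt_floor_add_one _
    · exact (Ordinal.opow_le_opow_iff_right Ordinal.one_lt_omega0).mp (hle _)
    · refine (Ordinal.opow_lt_opow_iff_right Ordinal.one_lt_omega0).mp ((hle x).trans_lt ?_)
      exact lt_of_le_of_ne x.2.2 fun h => hx (Subtype.ext h)
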